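/- Let $X$ be a compact metric space with metric $d$ and let $f\colon X\to X$ be a continuous map. We use the following notions. **Chains and shadowing.** Let $\mathscr U(X)$ be the set of finite open covers of $X$. For $\mathcal U\in\mathscr U(X)$, a $\mathcal U$-chain of $f$ of length $k>0$ is a finite sequence $(x_i)_{i=0}^k$ such that for each $0\le i\le k-1$ some $U_i\in\mathcal U$ contains both $f(x_i)$ and $x_{i+1}$; it is a $\mathcal U$-cycle if $x_0=x_k$. A $\mathcal U$-pseudo orbit is an infinite sequence $(x_i)_{i\ge0}$ with the same property for all $i\ge 0$. A sequence $(x_i)_{i\ge0}$ is $\mathcal V$-shadowed by $z\in X$ if for each $i\ge0$ some $V_i\in\mathcal V$ contains both $f^i(z)$ and $x_i$. The map $f$ is chain transitive if for all $x,y\in X$ and $\mathcal U\in\mathscr U(X)$ there is a $\mathcal U$-chain from $x$ to $y$. **The classes $\mathcal D(f)$ and DSP.** Let $f$ be chain transitive. For $\mathcal U\in\mathscr U(X)$ let $m(\mathcal U)$ be the greatest common divisor of the lengths of all $\mathcal U$-cycles. Write $x\sim_f y$ if for every $\mathcal U\in\mathscr U(X)$ there is a $\mathcal U$-chain from $x$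 to $y$ whose length is divisible by $m(\mathcal U)$; this is an equivalence relation, and $\mathcal D(f)$ denotes the set of its classes. For $\mathcal U,\mathcal V\in\mathscr U(X)$ let $\mathcal D^{\mathcal V,\mathcal U}(f)$ be the set of $D\in\mathcal D(f)$ such that every $\mathcal U$-pseudo orbit $(x_i)_{i\ge0}$ with $x_0\in D$ is $\mathcal V$-shadowed by some point of $D$. The map $f$ has the $\mathcal D$-shadowing property (DSP) if $$\mathcal D_{\rm sh}(f)=\bigcap_{\mathcal V\in\mathscr U(X)}\ \bigcup_{\mathcal U\in\mathscr U(X)}\mathcal D^{\mathcal V,\mathcal U}(f)\ne\emptyset .$$ **$\overline\omega$-chaos.** For $A\subset\{0,1,2,\dots\}$ let $\overline d(A)=\limsup_{n\to\infty}\frac1n|A\cap\{0,\dots,n-1\}|$. For $x\in X$ let $\overline\omega(x,f)$ be the set of $y\in X$ such that $\overline d(\{i\ge0\colon d(f^i(x),y)<\epsilon\})>0$ for all $\epsilon>0$. A set $S\subset X$ is $\overline\omega$-scrambled if for all $x,y\in S$ with $x\ne y$: (1) $\overline\omega(x,f)\setminus\overline\omega(y,f)$ is uncountable; (2) $\overline\omega(x,f)\cap\overline\omega(y,f)\ne\emptyset$;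 (3) $\overline\omega(x,f)$ contains a point that is not periodic for $f$. The map $f$ exhibits $\overline\omega$-chaos if there is an uncountable $\overline\omega$-scrambled subset of $X$. A subset $S$ of a topological space $Y$ is $\mathfrak c$-dense in $Y$ if $|U\cap S|=|\mathbb R|$ for every non-empty open subset $U$ of $Y$. **Theorem.** Let $f\colon X\to X$ be a chain transitive continuous map of a compact metric space $X$ with DSP and with positive topological entropy, $h_{\rm top}(f)>0$. Then there is an $\overline\omega$-scrambled subset $S$ of $X$ such that $D\cap S$ is $\mathfrak c$-dense in $D$ (with the subspace topology) for every $D\in\mathcal D(f)$, and $S$ is $\mathfrak c$-dense in $X$. In particular, $f$ exhibits $\overline\omega$-chaos. -/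

import Mathlib

open Set Filter Topology

noncomputable section

namespace OmegaBarChaos

universe u

variable {X : Type u}

/-! ### Chains, pseudo-orbits and shadowing with respect to finite open covers -/

/-- The set of finite open covers of `X`. -/
def finiteOpenCovers (X : Type u) [TopologicalSpace X] : Set (Set (Set X)) :=
  {𝒰 | 𝒰.Finite ∧ (∀ U ∈ 𝒰, IsOpen U) ∧ ⋃₀ 𝒰 = univ}

/-- `(x 0, …, x k)` is a `𝒰`-chain of `f` of length `k > 0`: for every `i < k`, some member of `𝒰`
contains both `f (x i)` and `x (i + 1)`. Only the values `x 0, …, x k` matter. -/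
def IsChainOf (f : X → X) (𝒰 : Set (Set X)) (k : ℕ) (x : ℕ → X) : Prop :=
  0 < k ∧ ∀ i < k, ∃ U ∈ 𝒰, f (x i) ∈ U ∧ x (i + 1) ∈ U

/-- `(x i)_{i ≥ 0}` is a `𝒰`-pseudo orbit of `f`. -/
def IsPseudoOrbit (f : X → X) (𝒰 : Set (Set X)) (x : ℕ → X) : Prop :=
  ∀ i, ∃ U ∈ 𝒰, f (x i) ∈ U ∧ x (i + 1) ∈ U

/-- The sequence `x` is `𝒱`-shadowed by the point `z`. -/
def IsShadowedBy (f : X → X) (𝒱 : Set (Set X)) (x : ℕ → X) (z : X) : Prop :=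
  ∀ i, ∃ V ∈ 𝒱, f^[i] z ∈ V ∧ x i ∈ V

/-- Chain transitivity: any two points are joined by a `𝒰`-chain, for every finite open cover. -/
def ChainTransitive [TopologicalSpace X] (f : X → X) : Prop :=
  ∀ x y : X, ∀ 𝒰 ∈ finiteOpenCovers X,
    ∃ (k : ℕ) (c : ℕ → X), IsChainOf f 𝒰 k c ∧ c 0 = x ∧ c k = y

/-! ### The relation `∼_f` and the `𝒟`-shadowing property -/

/-- The set of lengths of all `𝒰`-cycles of `f`. -/
def cycleLengths (f : X → X) (𝒰 : Set (Set X)) : Set ℕ :=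
  {k | ∃ c : ℕ → X, IsChainOf f 𝒰 k c ∧ c 0 = c k}

/-- `m(𝒰)`, the greatest common divisor of the lengths of all `𝒰`-cycles of `f`. -/
def cycleGcd (f : X → X) (𝒰 : Set (Set X)) : ℕ :=
  sSup {m | ∀ k ∈ cycleLengths f 𝒰, m ∣ k}

/-- The relation `x ∼_{f,𝒰} y`: there is a `𝒰`-chain from `x` to `y` of length divisible
by `m(𝒰)`. -/
def CoverRel (f : X → X) (𝒰 : Set (Set X)) (x y : X) : Prop :=
  ∃ (k : ℕ) (c : ℕ → X), IsChainOf f 𝒰 k c ∧ c 0 = x ∧ c k = y ∧ cycleGcd f 𝒰 ∣ k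

/-- The relation `x ∼_f y`: `x ∼_{f,𝒰} y` for every finite open cover `𝒰`. -/
def ChainRel [TopologicalSpace X] (f : X → X) (x y : X) : Prop :=
  ∀ 𝒰 ∈ finiteOpenCovers X, CoverRel f 𝒰 x y

/-- `𝒟(f)`, the set of equivalence classes of `∼_f`. -/
def chainClasses [TopologicalSpace X] (f : X → X) : Set (Set X) :=
  {D | ∃ x : X, D = {y | ChainRel f x y}}

/-- `𝒟^{𝒱,𝒰}(f)`: the classes `D` such that every `𝒰`-pseudo orbit starting in `D` is
`𝒱`-shadowed by some point of `D`. -/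
def shadowingClassesFor [TopologicalSpace X] (f : X → X) (𝒱 𝒰 : Set (Set X)) : Set (Set X) :=
  {D | D ∈ chainClasses f ∧
    ∀ x : ℕ → X, IsPseudoOrbit f 𝒰 x → x 0 ∈ D → ∃ z ∈ D, IsShadowedBy f 𝒱 x z}

/-- `𝒟_sh(f)`, the intersection over `𝒱` of the union over `𝒰` of `𝒟^{𝒱,𝒰}(f)`. -/
def shadowingClasses [TopologicalSpace X] (f : X → X) : Set (Set X) :=
  ⋂ 𝒱 ∈ finiteOpenCovers X, ⋃ 𝒰 ∈ finiteOpenCovers X, shadowingClassesFor f 𝒱 𝒰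

/-- The `𝒟`-shadowing property (DSP) of a chain transitive map, in the form `𝒟_sh(f) ≠ ∅`.
For a chain transitive continuous self-map of a nonempty compact Hausdorff space the conditions
`𝒟_sh(f) ≠ ∅`, `𝒟_sh(f) = 𝒟(f)` and `∀ 𝒱, ∃ 𝒰, 𝒟^{𝒱,𝒰}(f) = 𝒟(f)` are equivalent; the one used
here is the formally weakest. -/
def HasDSP [TopologicalSpace X] (f : X → X) : Prop :=
  (shadowingClasses f).Nonempty

/-! ### `ω̄`-limit sets and `ω̄`-chaos -/

/-- The upper density of a set of natural numbers. -/
def upperDensity (A : Set ℕ) : ℝ :=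
  limsup (fun n : ℕ => ((A ∩ Iio n).ncard : ℝ) / n) atTop

/-- The set of `ω̄`-limit points of `x` under `f`. -/
def omegaBar [MetricSpace X] (f : X → X) (x : X) : Set X :=
  {y | ∀ ε : ℝ, 0 < ε → 0 < upperDensity {i | f^[i] x ∈ Metric.ball y ε}}

/-- `ω̄`-scrambled sets. -/
def IsOmegaBarScrambled [MetricSpace X] (f : X → X) (S : Set X) : Prop :=
  ∀ x ∈ S, ∀ y ∈ S, x ≠ y →
    ¬ (omegaBar f x \ omegaBar f y).Countable ∧
    (omegaBar f x ∩ omegaBar f y).Nonempty ∧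
    (omegaBar f x \ Function.periodicPts f).Nonempty

/-- `f` exhibits `ω̄`-chaos: there is an uncountable `ω̄`-scrambled set. -/
def OmegaBarChaotic [MetricSpace X] (f : X → X) : Prop :=
  ∃ S : Set X, ¬ S.Countable ∧ IsOmegaBarScrambled f S

/-- `S` is `𝔠`-dense in the space `Y`: it meets every nonempty open set in a set of
cardinality `|ℝ|`. -/
def IsContinuumDense {Y : Type u} [TopologicalSpace Y] (S : Set Y) : Prop :=
  ∀ U : Set Y, IsOpen U → U.Nonempty → Cardinal.mk ↥(U ∩ S) = Cardinal.continuum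

end OmegaBarChaos

end

/-!
Write `x ∼ y` for `ChainRel f x y`. For every scale `δ` it compares lengths of `δ`-chains with the
greatest common divisor of the lengths of all `δ`-cycles.

*Shadowing in all classes.* DSP provides one class whose pseudo orbits are shadowed. Prolonging a
pseudo orbit `x` to the left by finer and finer chains from that class, and using compactness, one
finds a scale `δ`, depending on `ε` only, such that every `δ`-pseudo orbit `x` whatsoever is
`ε`-shadowed by some `z` with `x 0 ∼ z` (`ChainTransitive.exists_shadowing`).

*Many minimal sets.* Positive entropy gives large separated sets, hence two orbit pieces that are
apart at some time but begin and end close together. Closing them up by a common chain and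
shadowing, one obtains a horseshoe: for some `p`, a continuous function `φ` realizes every sequence
of zeros and ones along the orbits of `f^[p]` (`exists_horseshoe`). The points with balanced
itineraries of a given irrational frequency form a closed `f^[p]`-invariant set without periodic
points. Hence `f` has continuum many minimal sets without periodic points
(`continuum_le_mk_aperiodicMinimalSets`); these are pairwise disjoint and, being perfect,
uncountable.

*Prescribed `ω̄`-limit sets.* Let `M` and `N` be minimal sets. Shadowing repeatedly, with summable
errors, one finds close to any `x` some `z` with `x ∼ z` whose orbit follows, alternately, orbits in
`M` and in `N`, each for a time that dwarfs all that went before and the delay before the next one.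
The delays have density zero and visits in minimal sets have bounded gaps, so that the `ω̄`-limit
set of `z` is `M ∪ N` (`exists_omegaBar_eq_union`).

Fix one aperiodic minimal set `Q`. To every point, scale and real number assign its own aperiodic
minimal set `M ≠ Q`, and a point `z` as above, near the given point, with `ω̄`-limit set `M ∪ Q`.
The points `z` form the scrambled set.
-/

namespace OmegaBarChaos

/-! ### Chains for a step relation -/

section Chains

variable {X : Type*} {f : X → X} {R R' : X → X → Prop} {k l : ℕ} {x y z : X}

/-- `Reach f R k x y`: there is a chain of length `k` from `x` to `y`, in which each point `u` is
followed by some `v` with `R (f u) v`. The relation `R` is "some member of a cover contains both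
points" or "the distance is less than `δ`". Length `0` is allowed here. -/
def Reach (f : X → X) (R : X → X → Prop) : ℕ → X → X → Prop
  | 0, x, y => x = y
  | k + 1, x, y => ∃ u, Reach f R k x u ∧ R (f u) y

theorem Reach.trans (h : Reach f R k x y) (h' : Reach f R l y z) : Reach f R (k + l) x z := by
  induction l generalizing z with
  | zero => cases h'; exact h
  | succ l ih =>
    obtain ⟨u, hu, hz⟩ := h'
    exact ⟨u, ih hu, hz⟩

theorem Reach.mono (hR : ∀ p q, R p q → R' p q) (h : Reach f R k x y) : Reach f R' k x y := by
  induction k generalizing y with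
  | zero => exact h
  | succ k ih =>
    obtain ⟨u, hu, hy⟩ := h
    exact ⟨u, ih hu, hR _ _ hy⟩

theorem reach_of_seq {c : ℕ → X} (h : ∀ i < k, R (f (c i)) (c (i + 1))) :
    Reach f R k (c 0) (c k) := by
  induction k with
  | zero => rfl
  | succ k ih => exact ⟨c k, ih fun i hi => h i (by omega), h k (by omega)⟩

theorem Reach.exists_seq (h : Reach f R k x y) :
    ∃ c : ℕ → X, c 0 = x ∧ c k = y ∧ ∀ i < k, R (f (c i)) (c (i + 1)) := by
  induction k generalizing y with
  | zero => exact ⟨fun _ => x, rfl, h, by simp⟩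
  | succ k ih =>
    obtain ⟨u, hu, hy⟩ := h
    obtain ⟨c, h0, hk, hc⟩ := ih hu
    refine ⟨fun i => if i ≤ k then c i else y, by simp [h0], by simp, fun i hi => ?_⟩
    rcases Nat.lt_succ_iff_lt_or_eq.1 hi with hi | rfl
    · simpa [hi.le, Nat.succ_le_of_lt hi] using hc i hi
    · simpa [hk] using hy

theorem reach_iterate (hR : ∀ p, R p p) (k : ℕ) (x : X) : Reach f R k x (f^[k] x) := by
  induction k with
  | zero => rfl
  | succ k ih => exact ⟨_, ih, by rw [Function.iterate_succ_apply']; exact hR _⟩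

/-- There is an `R`-chain from `x` to `y` whose length is a multiple of every common divisor of the
lengths of the `R`-cycles, that is, of their greatest common divisor. -/
def CyclicRel (f : X → X) (R : X → X → Prop) (x y : X) : Prop :=
  ∃ k, 0 < k ∧ Reach f R k x y ∧ ∀ d, (∀ l > 0, ∀ u, Reach f R l u u → d ∣ l) → d ∣ k

theorem CyclicRel.mono (hR : ∀ p q, R p q → R' p q) (h : CyclicRel f R x y) :
    CyclicRel f R' x y := by
  obtain ⟨k, hk, hxy, hd⟩ := h
  exact ⟨k, hk, hxy.mono hR, fun d h => hd d fun l hl u hu => h l hl u (hu.mono hR)⟩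

theorem CyclicRel.trans (h : CyclicRel f R x y) (h' : CyclicRel f R y z) : CyclicRel f R x z := by
  obtain ⟨k, hk, hxy, hd⟩ := h
  obtain ⟨l, hl, hyz, hd'⟩ := h'
  exact ⟨k + l, by omega, hxy.trans hyz, fun d h => dvd_add (hd d h) (hd' d h)⟩

/-- Some member of `𝒰` contains both points. -/
def CoverStep (𝒰 : Set (Set X)) (p q : X) : Prop := ∃ U ∈ 𝒰, p ∈ U ∧ q ∈ U

theorem exists_isChainOf_iff {𝒰 : Set (Set X)} :
    (∃ c, IsChainOf f 𝒰 k c ∧ c 0 = x ∧ c k = y) ↔ 0 < k ∧ Reach f (CoverStep 𝒰) k x y := by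
  constructor
  · rintro ⟨c, ⟨hk, hc⟩, rfl, rfl⟩
    exact ⟨hk, reach_of_seq hc⟩
  · rintro ⟨hk, h⟩
    obtain ⟨c, h0, h1, hc⟩ := h.exists_seq
    exact ⟨c, ⟨hk, hc⟩, h0, h1⟩

theorem mem_cycleLengths {𝒰 : Set (Set X)} :
    k ∈ cycleLengths f 𝒰 ↔ 0 < k ∧ ∃ u, Reach f (CoverStep 𝒰) k u u := by
  constructor
  · rintro ⟨c, ⟨hk, hc⟩, h⟩
    exact ⟨hk, c 0, by simpa [← h] using reach_of_seq (R := CoverStep 𝒰) hc⟩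
  · rintro ⟨hk, u, h⟩
    obtain ⟨c, h0, h1, hc⟩ := h.exists_seq
    exact ⟨c, ⟨hk, hc⟩, h0.trans h1.symm⟩

/-- The `sSup` in the definition of `cycleGcd` is the greatest common divisor in the sense of
divisibility, as the common divisors are closed under `Nat.lcm`. -/
theorem cycleGcd_dvd_iff {𝒰 : Set (Set X)} (hne : (cycleLengths f 𝒰).Nonempty) :
    cycleGcd f 𝒰 ∣ k ↔ ∀ d, (∀ l > 0, ∀ u, Reach f (CoverStep 𝒰) l u u → d ∣ l) → d ∣ k := by
  have hS : ∀ d, d ∈ {m | ∀ k ∈ cycleLengths f 𝒰, m ∣ k} ↔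
      ∀ l > 0, ∀ u, Reach f (CoverStep 𝒰) l u u → d ∣ l := by
    intro d
    simp only [mem_ofPred_eq, mem_cycleLengths]
    exact ⟨fun h l hl u hu => h l ⟨hl, u, hu⟩, fun h l ⟨hl, u, hu⟩ => h l hl u hu⟩
  obtain ⟨L, hL⟩ := hne
  have hbdd : BddAbove {m | ∀ k ∈ cycleLengths f 𝒰, m ∣ k} :=
    ⟨L, fun m hm => Nat.le_of_dvd (mem_cycleLengths.1 hL).1 (hm L hL)⟩
  have hmem : cycleGcd f 𝒰 ∈ {m | ∀ k ∈ cycleLengths f 𝒰, m ∣ k} :=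
    Nat.sSup_mem ⟨1, fun k _ => one_dvd k⟩ hbdd
  constructor
  · intro h d hd
    refine dvd_trans ?_ h
    have hlcm : Nat.lcm d (cycleGcd f 𝒰) ∈ {m | ∀ k ∈ cycleLengths f 𝒰, m ∣ k} :=
      fun l hl => Nat.lcm_dvd ((hS d).2 hd l hl) (hmem l hl)
    have hle : Nat.lcm d (cycleGcd f 𝒰) ≤ cycleGcd f 𝒰 := le_csSup hbdd hlcm
    have hpos : 0 < Nat.lcm d (cycleGcd f 𝒰) :=
      Nat.pos_of_dvd_of_pos (hlcm L hL) (mem_cycleLengths.1 hL).1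
    have heq := Nat.dvd_antisymm (Nat.dvd_lcm_right d (cycleGcd f 𝒰))
      (by rw [le_antisymm hle (Nat.le_of_dvd hpos (Nat.dvd_lcm_right d _))])
    rw [heq]
    exact Nat.dvd_lcm_left _ _
  · intro h
    exact h _ ((hS _).1 hmem)

theorem coverRel_iff {𝒰 : Set (Set X)} (hne : (cycleLengths f 𝒰).Nonempty) :
    CoverRel f 𝒰 x y ↔ CyclicRel f (CoverStep 𝒰) x y := by
  constructor
  · rintro ⟨k, c, hc, h0, h1, hd⟩
    obtain ⟨hk, h⟩ := exists_isChainOf_iff.1 ⟨c, hc, h0, h1⟩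
    exact ⟨k, hk, h, (cycleGcd_dvd_iff hne).1 hd⟩
  · rintro ⟨k, hk, h, hd⟩
    obtain ⟨c, hc, h0, h1⟩ := exists_isChainOf_iff.2 ⟨hk, h⟩
    exact ⟨k, c, hc, h0, h1, (cycleGcd_dvd_iff hne).2 hd⟩

end Chains

/-! ### Metric form of the chain relation -/

section Metric

variable {X : Type*} [MetricSpace X] [CompactSpace X] {f : X → X}

/-- The distance is less than `δ`. -/
def DistStep {X : Type*} [MetricSpace X] (δ : ℝ) (p q : X) : Prop := dist p q < δ

theorem DistStep.mono {X : Type*} [MetricSpace X] {δ δ' : ℝ} (h : δ ≤ δ') (p q : X)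
    (hpq : DistStep δ p q) : DistStep δ' p q := lt_of_lt_of_le hpq h

theorem exists_cover_of_pos {δ : ℝ} (hδ : 0 < δ) :
    ∃ 𝒰 ∈ finiteOpenCovers X, ∀ p q, CoverStep 𝒰 p q → DistStep δ p q := by
  obtain ⟨t, -, htf, ht⟩ := (isCompact_univ (X := X)).finite_cover_balls (half_pos hδ)
  refine ⟨(fun c => Metric.ball c (δ / 2)) '' t, ⟨htf.image _, ?_, ?_⟩, ?_⟩
  · rintro _ ⟨c, -, rfl⟩
    exact Metric.isOpen_ball
  · rw [sUnion_image]
    exact univ_subset_iff.1 ht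
  · rintro p q ⟨_, ⟨c, -, rfl⟩, hp, hq⟩
    have := dist_triangle_right p q c
    rw [Metric.mem_ball] at hp hq
    unfold DistStep
    linarith

theorem exists_pos_of_cover {𝒰 : Set (Set X)} (h𝒰 : 𝒰 ∈ finiteOpenCovers X) :
    ∃ δ > 0, ∀ p q, DistStep δ p q → CoverStep 𝒰 p q := by
  obtain ⟨-, ho, hc⟩ := h𝒰
  obtain ⟨δ, hδ, h⟩ := lebesgue_number_lemma_of_metric_sUnion (isCompact_univ (X := X)) ho hc.ge
  refine ⟨δ, hδ, fun p q hpq => ?_⟩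
  obtain ⟨U, hU, hb⟩ := h p (mem_univ p)
  exact ⟨U, hU, hb (Metric.mem_ball_self hδ), hb (by rwa [Metric.mem_ball, dist_comm])⟩

theorem ChainTransitive.exists_reach (hct : ChainTransitive f) {δ : ℝ} (hδ : 0 < δ) (x y : X) :
    ∃ k > 0, Reach f (DistStep δ) k x y := by
  obtain ⟨𝒰, h𝒰, hstep⟩ := exists_cover_of_pos (X := X) hδ
  obtain ⟨k, c, h⟩ := hct x y 𝒰 h𝒰
  obtain ⟨hk, h⟩ := exists_isChainOf_iff.1 ⟨c, h⟩
  exact ⟨k, hk, h.mono hstep⟩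

theorem ChainTransitive.cycleLengths_nonempty {X : Type*} [TopologicalSpace X] {f : X → X}
    (hct : ChainTransitive f) (x : X) {𝒰 : Set (Set X)} (h𝒰 : 𝒰 ∈ finiteOpenCovers X) :
    (cycleLengths f 𝒰).Nonempty := by
  obtain ⟨k, c, h, h0, h1⟩ := hct x x 𝒰 h𝒰
  exact ⟨k, c, h, h0.trans h1.symm⟩

theorem ChainTransitive.chainRel_iff (hct : ChainTransitive f) {x y : X} :
    ChainRel f x y ↔ ∀ δ > 0, CyclicRel f (DistStep δ) x y := by
  constructor
  · intro h δ hδ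
    obtain ⟨𝒰, h𝒰, hstep⟩ := exists_cover_of_pos (X := X) hδ
    exact ((coverRel_iff (hct.cycleLengths_nonempty x h𝒰)).1 (h 𝒰 h𝒰)).mono hstep
  · intro h 𝒰 h𝒰
    obtain ⟨δ, hδ, hstep⟩ := exists_pos_of_cover h𝒰
    exact (coverRel_iff (hct.cycleLengths_nonempty x h𝒰)).2 ((h δ hδ).mono hstep)

theorem ChainTransitive.chainRel_refl (hct : ChainTransitive f) (x : X) : ChainRel f x x := by
  refine hct.chainRel_iff.2 fun δ hδ => ?_
  obtain ⟨k, hk, h⟩ := hct.exists_reach hδ x x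
  exact ⟨k, hk, h, fun d hd => hd k hk x h⟩

theorem ChainTransitive.chainRel_trans (hct : ChainTransitive f) {x y z : X}
    (h : ChainRel f x y) (h' : ChainRel f y z) : ChainRel f x z :=
  hct.chainRel_iff.2 fun δ hδ => (hct.chainRel_iff.1 h δ hδ).trans (hct.chainRel_iff.1 h' δ hδ)

/-- Changing the last point of a chain slightly gives a chain of the same length, so the relation is
closed in its second argument; it even suffices to have it at all scales along an approximating
sequence. -/
theorem ChainTransitive.chainRel_of_approx (hct : ChainTransitive f) {x y : X}
    (h : ∀ δ > 0, ∃ y', dist y' y < δ ∧ CyclicRel f (DistStep δ) x y') : ChainRel f x y := by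
  refine hct.chainRel_iff.2 fun δ hδ => ?_
  obtain ⟨y', hy', k, hk, hr, hd⟩ := h (δ / 2) (half_pos hδ)
  have hmono : ∀ p q : X, DistStep (δ / 2) p q → DistStep δ p q := DistStep.mono (by linarith)
  refine ⟨k, hk, ?_, fun d hd' => hd d fun l hl u hu => hd' l hl u (hu.mono hmono)⟩
  obtain ⟨k, rfl⟩ := Nat.exists_eq_succ_of_ne_zero hk.ne'
  obtain ⟨u, hu, huy⟩ := hr
  refine ⟨u, hu.mono hmono, ?_⟩
  have := dist_triangle (f u) y' y
  unfold DistStep at *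
  linarith

/-- By compactness, the lengths of chains needed at a given scale are bounded. -/
theorem ChainTransitive.exists_reach_le (hct : ChainTransitive f) {δ : ℝ} (hδ : 0 < δ) :
    ∃ N : ℕ, ∀ x y : X, ∃ k ≤ N, 0 < k ∧ Reach f (DistStep δ) k x y := by
  obtain ⟨t, -, htf, ht⟩ := (isCompact_univ (X := X)).finite_cover_balls (half_pos hδ)
  choose κ hκ hr using fun x y : X => hct.exists_reach (half_pos hδ) x y
  obtain ⟨N, hN⟩ := ((htf.prod htf).image fun q : X × X => κ q.1 q.2).bddAbove
  have hcov : ∀ x, ∃ c ∈ t, dist x c < δ / 2 := fun x => by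
    simpa [Metric.mem_ball] using ht (mem_univ x)
  refine ⟨1 + N, fun x y => ?_⟩
  obtain ⟨a, ha, hxa⟩ := hcov (f x)
  obtain ⟨b, hb, hyb⟩ := hcov y
  refine ⟨1 + κ a b, by
    have := hN ⟨(a, b), ⟨ha, hb⟩, rfl⟩
    simpa using this, by omega, ?_⟩
  have h1 : Reach f (DistStep δ) 1 x a := ⟨x, rfl, by unfold DistStep; linarith⟩
  refine h1.trans ?_
  obtain ⟨k, hk⟩ := Nat.exists_eq_succ_of_ne_zero (hκ a b).ne'
  have := hr a b
  rw [hk] at this ⊢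
  obtain ⟨u, hu, hub⟩ := this
  refine ⟨u, hu.mono (DistStep.mono (by linarith)), ?_⟩
  have := dist_triangle_right (f u) y b
  unfold DistStep at *
  linarith

/-- Under DSP, pseudo orbits are shadowed uniformly in all classes at once. A pseudo orbit starting
at `x 0` is prolonged to the left by an arbitrarily fine chain from the base point `a` of a class in
`𝒟_sh(f)`; the image, after the time of that chain, of a point shadowing the longer pseudo orbit is
related to `x 0` at an arbitrarily fine scale. A limit of these images is as wanted. -/
theorem ChainTransitive.exists_shadowing (hct : ChainTransitive f) (hf : Continuous f)
    (hdsp : HasDSP f) {ε : ℝ} (hε : 0 < ε) :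
    ∃ δ > 0, ∀ x : ℕ → X, (∀ i, dist (f (x i)) (x (i + 1)) < δ) →
      ∃ z, ChainRel f (x 0) z ∧ ∀ i, dist (f^[i] z) (x i) ≤ ε := by
  obtain ⟨D, hD⟩ := hdsp
  obtain ⟨𝒱, h𝒱, hstepV⟩ := exists_cover_of_pos (X := X) hε
  have hD' : ∃ 𝒰 ∈ finiteOpenCovers X, D ∈ shadowingClassesFor f 𝒱 𝒰 := by
    simpa [shadowingClasses] using mem_iInter₂.1 hD 𝒱 h𝒱
  obtain ⟨𝒰, h𝒰, ⟨a, rfl⟩, hsh⟩ := hD'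
  obtain ⟨δ, hδ, hstepU⟩ := exists_pos_of_cover h𝒰
  refine ⟨δ, hδ, fun x hx => ?_⟩
  have key : ∀ η > 0, ∃ y, CyclicRel f (DistStep η) (x 0) y ∧ ∀ i, dist (f^[i] y) (x i) < ε := by
    intro η hη
    obtain ⟨k, hk, hr⟩ := hct.exists_reach (lt_min hη hδ) a (x 0)
    obtain ⟨c, hc0, hck, hc⟩ := hr.exists_seq
    obtain ⟨z, hz, hsz⟩ := hsh (fun i => if i < k then c i else x (i - k))
      (fun i => by
        refine hstepU _ _ ?_
        rcases lt_trichotomy (i + 1) k with h | h | h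
        · have h' : i < k := by omega
          simpa [h, h'] using DistStep.mono (min_le_right _ _) _ _ (hc i h')
        · have h' : i < k := by omega
          subst h
          simpa [hck] using DistStep.mono (min_le_right _ _) _ _ (hc i h')
        · have h1 : ¬ i < k := by omega
          have h2 : ¬ i + 1 < k := by omega
          have h3 : i + 1 - k = i - k + 1 := by omega
          simpa [h1, h2, h3, DistStep] using hx (i - k))
      (by simpa [hk, hc0] using hct.chainRel_refl a)
    refine ⟨f^[k] z, ?_, fun i => ?_⟩
    · obtain ⟨j, hj, hjr, hjd⟩ := hct.chainRel_iff.1 hz η hη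
      obtain ⟨l, hl, hlr⟩ := hct.exists_reach hη (x 0) a
      have hr' : Reach f (DistStep η) k a (x 0) := hr.mono (DistStep.mono (min_le_left _ _))
      have hk' : Reach f (DistStep η) k z (f^[k] z) :=
        reach_iterate (fun p => by simpa [DistStep] using hη) k z
      refine ⟨l + j + k, by omega, (hlr.trans hjr).trans hk', fun d hd => ?_⟩
      have h1 : d ∣ l + k := hd (l + k) (by omega) _ (hlr.trans hr')
      rw [add_right_comm]
      exact dvd_add h1 (hjd d hd)
    · have := hstepV _ _ (hsz (k + i))
      simpa [add_comm k i, Function.iterate_add_apply, DistStep] using this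
  choose y hy hys using fun n : ℕ => key (1 / ((n : ℝ) + 1)) Nat.one_div_pos_of_nat
  obtain ⟨z, -, φ, hφ, hlim⟩ := (isCompact_univ (X := X)).tendsto_subseq fun n => mem_univ (y n)
  refine ⟨z, hct.chainRel_of_approx fun η hη => ?_, fun i => ?_⟩
  · have h1 : ∀ᶠ n in atTop, dist ((y ∘ φ) n) z < η := (Metric.tendsto_nhds.1 hlim) η hη
    have h2 : ∀ᶠ n in atTop, 1 / (((φ n : ℕ) : ℝ) + 1) < η :=
      (tendsto_one_div_add_atTop_nhds_zero_nat.comp hφ.tendsto_atTop).eventually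
        (gt_mem_nhds hη)
    obtain ⟨n, hn1, hn2⟩ := (h1.and h2).exists
    exact ⟨y (φ n), hn1, (hy (φ n)).mono (DistStep.mono hn2.le)⟩
  · have hc : Tendsto (fun n => dist (f^[i] (y (φ n))) (x i)) atTop (𝓝 (dist (f^[i] z) (x i))) :=
      (((hf.iterate i).tendsto z).comp hlim).dist tendsto_const_nhds
    exact le_of_tendsto hc (Eventually.of_forall fun n => (hys (φ n) i).le)

end Metric

/-! ### A horseshoe from positive entropy and shadowing -/

section Horseshoe

variable {X : Type*} [MetricSpace X] {f : X → X}

/-- Positive entropy is used only through the unboundedness, at some scale, of the cardinalities of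
separated sets. -/
theorem exists_separated_of_coverEntropy_pos
    (hent : 0 < Dynamics.coverEntropy f (univ : Set X)) :
    ∃ e > 0, ∀ N : ℕ, ∃ (n : ℕ) (s : Finset X), N < s.card ∧
      ∀ x ∈ s, ∀ y ∈ s, x ≠ y → ∃ i < n, e ≤ dist (f^[i] x) (f^[i] y) := by
  rw [Dynamics.coverEntropy_eq_iSup_netEntropyEntourage] at hent
  simp only [lt_iSup_iff] at hent
  obtain ⟨U, hU, hent⟩ := hent
  obtain ⟨e, he, heU⟩ := Metric.mem_uniformity_dist.1 hU
  refine ⟨e, he, fun N => ?_⟩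
  by_contra! hN
  refine absurd hent (not_lt.2 ?_)
  have hle : ∀ n, (Dynamics.netMaxcard f univ U n : ENNReal) ≤ ((N + 1 : ℕ) : ENNReal) := by
    intro n
    have : Dynamics.netMaxcard f univ U n ≤ ((N + 1 : ℕ) : ℕ∞) := by
      refine iSup₂_le fun s hs => ?_
      by_contra! hlt
      have hlt' : N < s.card := by
        have : N + 1 < s.card := by exact_mod_cast hlt
        omega
      obtain ⟨x, hx, y, hy, hxy, hd⟩ := hN n s hlt'
      refine Set.disjoint_left.1 (hs.2 hx hy hxy) (?_ : y ∈ _) ?_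
      · rw [Dynamics.mem_ball_dynEntourage]
        exact fun k hk => heU (hd k hk)
      · rw [Dynamics.mem_ball_dynEntourage]
        exact fun k hk => heU (by simpa using he)
    exact_mod_cast ENat.toENNReal_mono this
  calc Dynamics.netEntropyEntourage f univ U
      ≤ ExpGrowth.expGrowthSup fun _ : ℕ => ((N + 1 : ℕ) : ENNReal) :=
        ExpGrowth.expGrowthSup_monotone hle
    _ = 0 := ExpGrowth.expGrowthSup_const (by simp) (by simp)

/-- Periodic blocks: from two orbit pieces of length `n` with nearby beginnings and ends, and a
common chain leading back, every itinerary `u` gives a pseudo orbit. -/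
theorem exists_pseudoOrbit_of_blocks {n l : ℕ} (hn : 0 < n) (hl : 0 < l) {δ : ℝ} {x : X}
    (hr : Reach f (DistStep (δ / 2)) l (f^[n] x) x) (u : ℕ → X) (hu : ∀ j, dist (u j) x < δ / 2)
    (hun : ∀ j, dist (f^[n] (u j)) (f^[n] x) < δ / 2) :
    ∃ w : ℕ → X, (∀ m, dist (f (w m)) (w (m + 1)) < δ) ∧
      ∀ j, ∀ i < n, w ((n + l) * j + i) = f^[i] (u j) := by
  have hδ : 0 < δ / 2 := dist_nonneg.trans_lt (hu 0)
  obtain ⟨c, hc0, hcl, hc⟩ := hr.exists_seq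
  set p := n + l with hp
  have hp0 : 0 < p := by omega
  let w : ℕ → X := fun m => if m % p < n then f^[m % p] (u (m / p)) else c (m % p - n)
  have hw : ∀ j r, r < p → w (p * j + r) = if r < n then f^[r] (u j) else c (r - n) := by
    intro j r hr
    have h1 : (p * j + r) % p = r := by rw [Nat.mul_add_mod, Nat.mod_eq_of_lt hr]
    have h2 : (p * j + r) / p = j := by
      rw [Nat.mul_add_div hp0, Nat.div_eq_of_lt hr, add_zero]
    simp only [w, h1, h2]
  refine ⟨w, fun m => ?_, fun j i hi => by rw [hw j i (by omega), if_pos hi]⟩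
  obtain ⟨j, r, hr, rfl⟩ : ∃ j r, r < p ∧ m = p * j + r :=
    ⟨m / p, m % p, Nat.mod_lt _ hp0, (Nat.div_add_mod m p).symm⟩
  rw [hw j r hr]
  rcases Nat.lt_or_ge (r + 1) p with h | h
  · rw [add_assoc, hw j (r + 1) h]
    rcases lt_trichotomy (r + 1) n with h' | h' | h'
    · rw [if_pos (by omega), if_pos h', Function.iterate_succ_apply', dist_self]
      linarith
    · rw [if_pos (by omega), if_neg (by omega), ← Function.iterate_succ_apply' f]
      simp only [Nat.succ_eq_add_one, h', Nat.sub_self, hc0]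
      linarith [hun j]
    · rw [if_neg (by omega), if_neg (by omega)]
      have := hc (r - n) (by omega)
      rw [show r + 1 - n = r - n + 1 by omega]
      unfold DistStep at this
      linarith
  · have hr' : p * j + r + 1 = p * (j + 1) + 0 := by rw [mul_add]; omega
    rw [hr', hw (j + 1) 0 hp0, if_neg (by omega), if_pos hn]
    have := hc (r - n) (by omega)
    rw [show r - n + 1 = l by omega, hcl] at this
    have h3 := dist_triangle_right (f (c (r - n))) (u (j + 1)) x
    have h4 := hu (j + 1)
    unfold DistStep at this
    simp only [Function.iterate_zero, id]
    linarith

/-- For some period `p`, a continuous function realizes every sequence of zeros and ones along the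
orbits of `f^[p]`. By the pigeonhole principle, a sufficiently large separated set contains two
points whose orbit pieces begin close together and end close together; they are the two blocks. -/
theorem exists_horseshoe [CompactSpace X] (hf : Continuous f) (hct : ChainTransitive f)
    (hdsp : HasDSP f) (hent : 0 < Dynamics.coverEntropy f (univ : Set X)) :
    ∃ p > 0, ∃ φ : X → ℝ, Continuous φ ∧
      ∀ s : ℕ → Bool, ∃ z, ∀ j, φ (f^[p * j] z) = if s j then 1 else 0 := by
  obtain ⟨e, he, hsep⟩ := exists_separated_of_coverEntropy_pos hent
  obtain ⟨δ, hδ, hsh⟩ := hct.exists_shadowing hf hdsp (ε := e / 3) (by linarith)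
  obtain ⟨t, -, htf, ht⟩ :=
    (isCompact_univ (X := X)).finite_cover_balls (show 0 < δ / 4 by linarith)
  have hcov : ∀ x, ∃ c ∈ htf.toFinset, dist x c < δ / 4 := fun x => by
    simpa [Metric.mem_ball] using ht (mem_univ x)
  choose b hb hbd using hcov
  have hclose : ∀ x y, b x = b y → dist x y < δ / 2 := fun x y h => by
    have h1 := hbd x
    have h2 := hbd y
    rw [← h] at h2
    linarith [dist_triangle_right x y (b x)]
  obtain ⟨n, s, hs, hsd⟩ := hsep (htf.toFinset ×ˢ htf.toFinset).card
  obtain ⟨x, hx, y, hy, hxy, heq⟩ := Finset.exists_ne_map_eq_of_card_lt_of_maps_to hs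
    (f := fun x => (b x, b (f^[n] x))) (fun x _ => by
      simpa using And.intro (by simpa using hb x) (by simpa using hb (f^[n] x)))
  simp only [Prod.mk.injEq] at heq
  obtain ⟨i, hi, hid⟩ := hsd x hx y hy hxy
  obtain ⟨l, hl, hr⟩ := hct.exists_reach (half_pos hδ) (f^[n] x) x
  obtain ⟨φ, h0, h1, -⟩ := exists_continuous_zero_one_of_isClosed
    (Metric.isClosed_closedBall (x := f^[i] x) (ε := e / 3))
    (Metric.isClosed_closedBall (x := f^[i] y) (ε := e / 3))
    (Metric.closedBall_disjoint_closedBall (by linarith))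
  refine ⟨n + l, by omega, φ, φ.continuous, fun s => ?_⟩
  obtain ⟨w, hw, hwu⟩ := exists_pseudoOrbit_of_blocks (by omega) hl hr
    (fun j => if s j then y else x)
    (fun j => by
      split_ifs
      · exact hclose y x heq.1.symm
      · simpa using hδ)
    (fun j => by
      split_ifs
      · exact hclose _ _ heq.2.symm
      · simpa using hδ)
  obtain ⟨z, -, hz⟩ := hsh w hw
  refine ⟨f^[i] z, fun j => ?_⟩
  have hzj := hz ((n + l) * j + i)
  rw [hwu j i hi, Function.iterate_add_apply] at hzj
  cases hsj : s j
  · simp only [hsj] at hzj ⊢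
    simpa using h0 (Metric.mem_closedBall.2 hzj)
  · simp only [hsj] at hzj ⊢
    simpa using h1 (Metric.mem_closedBall.2 hzj)

end Horseshoe

/-! ### Minimal sets -/

section Minimal

variable {X : Type*} [MetricSpace X] {f : X → X} {M N Z : Set X}

/-- `Z` is a nonempty closed set mapped into itself by `f`. -/
structure IsClosedInvariant {X : Type*} [TopologicalSpace X] (f : X → X) (Z : Set X) : Prop where
  isClosed : IsClosed Z
  nonempty : Z.Nonempty
  mapsTo : MapsTo f Z Z

/-- `M` is a minimal set of `f`: minimal among the nonempty closed forward invariant sets. -/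
def IsMinimalSet {X : Type*} [TopologicalSpace X] (f : X → X) (M : Set X) : Prop :=
  Minimal (IsClosedInvariant f) M

theorem IsClosedInvariant.exists_isMinimalSet [CompactSpace X] (hZ : IsClosedInvariant f Z) :
    ∃ M ⊆ Z, IsMinimalSet f M := by
  refine zorn_superset_nonempty {Z | IsClosedInvariant f Z} (fun c hc hch hne => ?_) Z hZ
  refine ⟨⋂₀ c, ⟨isClosed_sInter fun s hs => (hc hs).isClosed, ?_, fun x hx s hs =>
    (hc hs).mapsTo (hx s hs)⟩, fun s hs => sInter_subset_of_mem hs⟩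
  have : Nonempty c := hne.to_subtype
  exact IsCompact.nonempty_sInter_of_directed_nonempty_isCompact_isClosed
    (fun a ha b hb => (hch.total ha hb).elim (fun h => ⟨a, ha, subset_rfl, h⟩)
      fun h => ⟨b, hb, h, subset_rfl⟩) (fun s hs => (hc hs).nonempty)
    (fun s hs => (hc hs).isClosed.isCompact) fun s hs => (hc hs).isClosed

theorem IsMinimalSet.eq_of_inter_nonempty (hM : IsMinimalSet f M) (hN : IsMinimalSet f N)
    (h : (M ∩ N).Nonempty) : M = N := by
  have hMN : IsClosedInvariant f (M ∩ N) := ⟨hM.prop.isClosed.inter hN.prop.isClosed, h,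
    hM.prop.mapsTo.inter_inter hN.prop.mapsTo⟩
  exact (hM.eq_of_subset hMN inter_subset_left).symm.trans
    (hN.eq_of_subset hMN inter_subset_right)

theorem IsMinimalSet.exists_iterate_mem (hf : Continuous f) (hM : IsMinimalSet f M) {x : X}
    (hx : x ∈ M) {U : Set X} (hU : IsOpen U) (hMU : (U ∩ M).Nonempty) : ∃ n, f^[n] x ∈ U := by
  have horb : range (fun n => f^[n] x) ⊆ M := by
    rintro _ ⟨n, rfl⟩
    exact hM.prop.mapsTo.iterate n hx
  have hinv : IsClosedInvariant f (closure (range fun n => f^[n] x)) := by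
    refine ⟨isClosed_closure, ⟨x, subset_closure ⟨0, rfl⟩⟩, MapsTo.closure ?_ hf⟩
    rintro _ ⟨n, rfl⟩
    exact ⟨n + 1, Function.iterate_succ_apply' f n x⟩
  have heq := hM.eq_of_subset hinv (closure_minimal horb hM.prop.isClosed)
  obtain ⟨y, hyU, hyM⟩ := hMU
  rw [← heq] at hyM
  obtain ⟨_, hU', n, rfl⟩ := mem_closure_iff.1 hyM U hU hyU
  exact ⟨n, hU'⟩

/-- Visits of the orbits in a minimal set to an open set meeting it have bounded gaps. -/
theorem IsMinimalSet.exists_iterate_mem_lt [CompactSpace X] (hf : Continuous f)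
    (hM : IsMinimalSet f M) {U : Set X} (hU : IsOpen U) (hMU : (U ∩ M).Nonempty) :
    ∃ r > 0, ∀ x ∈ M, ∃ n < r, f^[n] x ∈ U := by
  obtain ⟨t, ht⟩ := hM.prop.isClosed.isCompact.elim_finite_subcover (fun n => f^[n] ⁻¹' U)
    (fun n => hU.preimage (hf.iterate n)) fun x hx => by
      simpa using hM.exists_iterate_mem hf hx hU hMU
  refine ⟨t.sup id + 1, by omega, fun x hx => ?_⟩
  obtain ⟨n, hn, hxn⟩ : ∃ n ∈ t, f^[n] x ∈ U := by simpa using ht hx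
  exact ⟨n, Nat.lt_succ_of_le (Finset.le_sup (f := id) hn), hxn⟩

/-- A minimal set without periodic points is perfect. -/
theorem IsMinimalSet.not_countable [CompactSpace X] (hf : Continuous f) (hM : IsMinimalSet f M)
    (hper : ∀ x ∈ M, x ∉ Function.periodicPts f) : ¬ M.Countable := by
  have hperf : Perfect M := by
    refine ⟨hM.prop.isClosed, preperfect_iff_nhds.2 fun x hx U hU => ?_⟩
    obtain ⟨n, hn⟩ := hM.exists_iterate_mem hf (hM.prop.mapsTo hx) isOpen_interior
      ⟨x, mem_interior_iff_mem_nhds.2 hU, hx⟩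
    refine ⟨f^[n] (f x), ⟨interior_subset hn, hM.prop.mapsTo.iterate n (hM.prop.mapsTo hx)⟩,
      fun h => hper x hx ?_⟩
    exact Function.mk_mem_periodicPts (n := n + 1) (Nat.succ_pos n) h
  obtain ⟨g, hgM, -, hg⟩ := hperf.exists_nat_bool_injection hM.prop.nonempty
  intro hc
  have hr : (range g).Countable := hc.mono hgM
  have := hr.preimage hg
  rw [preimage_range] at this
  have hle := Cardinal.mk_le_aleph0_iff.2 (countable_univ_iff.1 this)
  simp only [Cardinal.mk_pi, Cardinal.mk_bool, Cardinal.prod_const, Cardinal.lift_id,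
    Cardinal.mk_nat, Cardinal.two_power_aleph0] at hle
  exact absurd hle (not_le.2 (by simpa using Cardinal.aleph0_lt_continuum))

end Minimal

/-! ### Points with Sturmian itineraries -/

section Sturmian

variable {X : Type*} {f : X → X} {φ : X → ℝ} {α β : ℝ}

/-- The points whose itinerary under `f`, read off by `φ`, is a balanced sequence of zeros and ones
with frequency `α`: every sum over `L` consecutive terms differs from `L * α` by at most `1`. -/
def balancedSet (f : X → X) (φ : X → ℝ) (α : ℝ) : Set X :=
  {x | (∀ j, φ (f^[j] x) = 0 ∨ φ (f^[j] x) = 1) ∧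
    ∀ a L : ℕ, |∑ i ∈ Finset.range L, φ (f^[a + i] x) - L * α| ≤ 1}

theorem isClosed_balancedSet [TopologicalSpace X] (hf : Continuous f) (hφ : Continuous φ) :
    IsClosed (balancedSet f φ α) := by
  have h : ∀ j, Continuous fun x => φ (f^[j] x) := fun j => hφ.comp (hf.iterate j)
  simp only [balancedSet, ofPred_and, ofPred_forall]
  refine (isClosed_iInter fun j => ?_).inter (isClosed_iInter fun a => isClosed_iInter fun L => ?_)
  · exact (isClosed_eq (h j) continuous_const).union (isClosed_eq (h j) continuous_const)
  · exact isClosed_le ((continuous_finsetSum _ fun i _ => h (a + i)).sub continuous_const).abs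
      continuous_const

theorem mapsTo_balancedSet : MapsTo f (balancedSet f φ α) (balancedSet f φ α) := by
  rintro x ⟨h1, h2⟩
  refine ⟨fun j => h1 (j + 1), fun a L => ?_⟩
  have := h2 (a + 1) L
  simpa only [← Function.iterate_succ_apply, Nat.succ_eq_add_one, add_right_comm] using this

/-- The lower mechanical word of slope `α`. -/
theorem balancedSet_nonempty (h : ∀ s : ℕ → Bool, ∃ z, ∀ j, φ (f^[j] z) = if s j then 1 else 0)
    (h0 : 0 ≤ α) (h1 : α < 1) : (balancedSet f φ α).Nonempty := by
  obtain ⟨z, hz⟩ := h fun j => decide (⌊((j + 1 : ℕ) : ℝ) * α⌋ - ⌊(j : ℝ) * α⌋ = 1)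
  have hz' : ∀ j : ℕ, φ (f^[j] z) = ((⌊((j + 1 : ℕ) : ℝ) * α⌋ : ℤ) : ℝ) - (⌊(j : ℝ) * α⌋ : ℤ) := by
    intro j
    have ha : ⌊(j : ℝ) * α⌋ ≤ ⌊((j + 1 : ℕ) : ℝ) * α⌋ :=
      Int.floor_mono (by push_cast; nlinarith)
    have hb : ⌊((j + 1 : ℕ) : ℝ) * α⌋ < ⌊(j : ℝ) * α⌋ + 2 := by
      rw [Int.floor_lt]
      have := Int.lt_floor_add_one ((j : ℝ) * α)
      push_cast
      linarith
    rw [hz j]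
    by_cases hj : ⌊((j + 1 : ℕ) : ℝ) * α⌋ - ⌊(j : ℝ) * α⌋ = 1
    · simp only [hj, decide_true, if_true]
      exact_mod_cast hj.symm
    · simp only [hj, decide_false, Bool.false_eq_true, if_false]
      have : ⌊((j + 1 : ℕ) : ℝ) * α⌋ - ⌊(j : ℝ) * α⌋ = 0 := by omega
      exact_mod_cast this.symm
  refine ⟨z, fun j => ?_, fun a L => ?_⟩
  · rw [hz j]
    split_ifs <;> simp
  · have hsum : ∑ i ∈ Finset.range L, φ (f^[a + i] z) =
        ((⌊((a + L : ℕ) : ℝ) * α⌋ : ℤ) : ℝ) - (⌊(a : ℝ) * α⌋ : ℤ) := by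
      simp only [hz']
      exact Finset.sum_range_sub (fun i => ((⌊((a + i : ℕ) : ℝ) * α⌋ : ℤ) : ℝ)) L
    rw [hsum, abs_le]
    have h2 := Int.lt_floor_add_one ((a : ℝ) * α)
    have h3 := Int.floor_le ((a : ℝ) * α)
    have h4 := Int.lt_floor_add_one (((a + L : ℕ) : ℝ) * α)
    have h5 := Int.floor_le (((a + L : ℕ) : ℝ) * α)
    push_cast at h4 h5 ⊢
    constructor <;> linarith

theorem eq_zero_of_forall_nat_mul_le {t C : ℝ} (h : ∀ m : ℕ, |m * t| ≤ C) : t = 0 := by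
  by_contra ht
  obtain ⟨m, hm⟩ := exists_nat_gt (C / |t|)
  rw [div_lt_iff₀ (abs_pos.2 ht)] at hm
  have := h m
  rw [abs_mul, Nat.abs_cast] at this
  linarith

theorem eq_of_mem_balancedSet {x : X} (hα : x ∈ balancedSet f φ α) (hβ : x ∈ balancedSet f φ β) :
    α = β := by
  refine sub_eq_zero.1 (eq_zero_of_forall_nat_mul_le (C := 2) fun m => ?_)
  have h1 := abs_le.1 (hα.2 0 m)
  have h2 := abs_le.1 (hβ.2 0 m)
  rw [abs_le]
  constructor <;> linarith

/-- A periodic itinerary has a rational frequency. -/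
theorem notMem_periodicPts_of_mem_balancedSet (hα : Irrational α) {x : X}
    (hx : x ∈ balancedSet f φ α) : x ∉ Function.periodicPts f := by
  rintro ⟨q, hq, hper⟩
  set S := ∑ i ∈ Finset.range q, φ (f^[i] x) with hS
  have hSint : ∃ k : ℕ, S = k := by
    choose v hv using fun j : ℕ => (show ∃ v : ℕ, φ (f^[j] x) = v by
      rcases hx.1 j with h | h
      · exact ⟨0, by simpa using h⟩
      · exact ⟨1, by simpa using h⟩)
    exact ⟨∑ i ∈ Finset.range q, v i, by simp [hS, hv]⟩
  have hmul : ∀ m : ℕ, ∑ i ∈ Finset.range (m * q), φ (f^[i] x) = m * S := by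
    intro m
    induction m with
    | zero => simp
    | succ m ih =>
      rw [Nat.succ_mul, Finset.sum_range_add, ih]
      have : ∀ i, f^[m * q + i] x = f^[i] x := fun i => by
        rw [add_comm, Function.iterate_add_apply, mul_comm, (hper.mul_const m).eq]
      simp only [this]
      push_cast
      ring
  have hzero : S - q * α = 0 := eq_zero_of_forall_nat_mul_le (C := 1) fun m => by
    have := hx.2 0 (m * q)
    simp only [zero_add, hmul] at this
    push_cast at this
    rwa [show (m : ℝ) * (S - q * α) = m * S - m * q * α by ring]
  obtain ⟨k, hk⟩ := hSint
  have hq' : (q : ℝ) ≠ 0 := by exact_mod_cast hq.ne'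
  refine hα ⟨(k : ℚ) / q, ?_⟩
  push_cast
  rw [div_eq_iff hq', ← hk]
  linarith

end Sturmian

/-! ### Continuum many minimal sets without periodic points -/

open Cardinal in
theorem continuum_le_mk_irrational_Ioo : 𝔠 ≤ #{α : ℝ // Irrational α ∧ α ∈ Ioo (0 : ℝ) 1} := by
  by_contra! hlt
  have hsub : Ioo (0 : ℝ) 1 ⊆ {α | Irrational α ∧ α ∈ Ioo (0 : ℝ) 1} ∪ range ((↑) : ℚ → ℝ) := by
    intro α hα
    by_cases h : α ∈ range ((↑) : ℚ → ℝ)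
    · exact Or.inr h
    · exact Or.inl ⟨h, hα⟩
  have h1 := (mk_le_mk_of_subset hsub).trans (mk_union_le _ _)
  rw [mk_Ioo_real zero_lt_one] at h1
  refine absurd h1 (not_le.2 (add_lt_of_lt aleph0_le_continuum hlt ?_))
  exact ((countable_range _).le_aleph0).trans_lt aleph0_lt_continuum

/-- The minimal sets of `f` without periodic points. -/
def aperiodicMinimalSets {X : Type*} [TopologicalSpace X] (f : X → X) : Set (Set X) :=
  {M | IsMinimalSet f M ∧ ∀ x ∈ M, x ∉ Function.periodicPts f}

open Cardinal in
/-- Each irrational `α` in `(0, 1)` yields a minimal set inside the set of those points that enter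
the balanced set of `f^[p]` of frequency `α` before time `p`. A point of the minimal set together
with that entry time determines `α`. -/
theorem continuum_le_mk_aperiodicMinimalSets {X : Type u} [MetricSpace X] [CompactSpace X]
    {f : X → X} (hf : Continuous f) (hct : ChainTransitive f) (hdsp : HasDSP f)
    (hent : 0 < Dynamics.coverEntropy f (univ : Set X)) :
    𝔠 ≤ #(aperiodicMinimalSets f) := by
  obtain ⟨p, hp, φ, hφ, hreal⟩ := exists_horseshoe hf hct hdsp hent
  simp only [Function.iterate_mul] at hreal
  set Y : ℝ → Set X := balancedSet f^[p] φ with hY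
  have hex : ∀ α : {α : ℝ // Irrational α ∧ α ∈ Ioo (0 : ℝ) 1},
      ∃ M ∈ aperiodicMinimalSets f, ∀ x ∈ M, ∃ i < p, f^[i] x ∈ Y α := by
    rintro ⟨α, hα, hα0, hα1⟩
    have hinv : IsClosedInvariant f (⋃ i ∈ Finset.range p, f^[i] ⁻¹' Y α) := by
      refine ⟨isClosed_biUnion_finset fun i _ =>
        (isClosed_balancedSet (hf.iterate p) hφ).preimage (hf.iterate i), ?_, ?_⟩
      · obtain ⟨z, hz⟩ := balancedSet_nonempty hreal hα0.le hα1
        exact ⟨z, mem_biUnion (x := 0) (by simpa using hp) hz⟩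
      · intro x hx
        simp only [mem_iUnion, Finset.mem_range, mem_preimage, exists_prop] at hx ⊢
        obtain ⟨i, hi, hxi⟩ := hx
        rcases i with _ | i
        · refine ⟨p - 1, by omega, ?_⟩
          rw [← Function.iterate_succ_apply, show (p - 1).succ = p by omega]
          exact mapsTo_balancedSet hxi
        · exact ⟨i, by omega, hxi⟩
    obtain ⟨M, hMZ, hM⟩ := hinv.exists_isMinimalSet
    have hent' : ∀ x ∈ M, ∃ i < p, f^[i] x ∈ Y α := fun x hx => by simpa using hMZ hx
    refine ⟨M, ⟨hM, fun x hx hper => ?_⟩, hent'⟩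
    obtain ⟨i, -, hi⟩ := hent' x hx
    refine notMem_periodicPts_of_mem_balancedSet hα hi ?_
    obtain ⟨q, hq, hxq⟩ := hper
    refine ⟨q, hq, ?_⟩
    have h1 : Function.IsPeriodicPt f q (f^[i] x) := hxq.apply_iterate i
    have h2 := h1.mul_const p
    rw [Function.IsPeriodicPt, ← Function.iterate_mul, mul_comm]
    exact h2
  choose M hM hMi using hex
  have hpt : ∀ N : aperiodicMinimalSets f, (N : Set X).Nonempty := fun N => N.2.1.prop.nonempty
  choose pt hpt using hpt
  choose ι _ hι using fun α => hMi α _ (hpt ⟨M α, hM α⟩)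
  have hinj : Function.Injective fun α => ((⟨M α, hM α⟩ : aperiodicMinimalSets f), ι α) := by
    intro α β h
    obtain ⟨h1, h2⟩ := Prod.mk.inj h
    have hα := hι α
    rw [h1, h2] at hα
    exact Subtype.ext (eq_of_mem_balancedSet hα (hι β))
  have hle := Cardinal.mk_le_of_injective (α := ULift.{u} _) (hinj.comp ULift.down_injective)
  rw [mk_uLift] at hle
  have hc := (lift_le.{u}.2 continuum_le_mk_irrational_Ioo).trans hle
  rw [lift_continuum, mk_prod, lift_uzero, mk_nat, lift_aleph0] at hc
  by_contra! hlt
  exact absurd hc (not_le.2 (mul_lt_of_lt aleph0_le_continuum hlt aleph0_lt_continuum))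

/-! ### Upper density -/

theorem ncard_inter_Iio_le (A : Set ℕ) (n : ℕ) : (A ∩ Iio n).ncard ≤ n := by
  calc (A ∩ Iio n).ncard ≤ (Iio n).ncard := ncard_le_ncard inter_subset_right (finite_Iio n)
    _ = n := by rw [← Finset.coe_Iio, ncard_coe_finset, Nat.card_Iio]

theorem ncard_inter_Iio_div_le_one (A : Set ℕ) (n : ℕ) : ((A ∩ Iio n).ncard : ℝ) / n ≤ 1 :=
  div_le_one_of_le₀ (by exact_mod_cast ncard_inter_Iio_le A n) n.cast_nonneg

theorem upperDensity_pos {A : Set ℕ} {C : ℕ}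
    (h : ∃ᶠ n : ℕ in atTop, 0 < n ∧ n ≤ C * (A ∩ Iio n).ncard) : 0 < upperDensity A := by
  obtain ⟨m, hm0, hm⟩ := h.exists
  have hC : (0 : ℝ) < C := by
    rcases Nat.eq_zero_or_pos C with rfl | hC
    · omega
    · exact_mod_cast hC
  refine (inv_pos.2 hC).trans_le (le_limsup_of_frequently_le (h.mono fun n hn => ?_) ?_)
  · have h0 : (0 : ℝ) < n := by exact_mod_cast hn.1
    have h1 : (n : ℝ) ≤ C * (A ∩ Iio n).ncard := by exact_mod_cast hn.2
    rw [inv_eq_one_div, div_le_div_iff₀ hC h0]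
    linarith
  · exact isBoundedUnder_of ⟨1, ncard_inter_Iio_div_le_one A⟩

theorem upperDensity_nonpos {A : Set ℕ}
    (h : ∀ j : ℕ, ∀ᶠ n : ℕ in atTop, j * (A ∩ Iio n).ncard ≤ 2 * n) : upperDensity A ≤ 0 := by
  refine le_of_forall_pos_le_add fun c hc => ?_
  rw [zero_add]
  obtain ⟨j, hj⟩ := exists_nat_gt (2 / c)
  rw [div_lt_iff₀ hc] at hj
  refine limsup_le_of_le (isCoboundedUnder_le_of_le atTop (x := 0) fun n => by positivity) ?_
  filter_upwards [h j, eventually_gt_atTop 0] with n hn hn0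
  have h0 : (0 : ℝ) < n := by exact_mod_cast hn0
  have h1 : (j : ℝ) * (A ∩ Iio n).ncard ≤ 2 * n := by exact_mod_cast hn
  have hj0 : (0 : ℝ) < j := by
    by_contra! hneg
    nlinarith
  rw [div_le_iff₀ h0]
  have h2 : (j : ℝ) * (A ∩ Iio n).ncard ≤ j * (c * n) := by nlinarith
  exact le_of_mul_le_mul_left h2 hj0

/-! ### Tracing a sequence of orbits -/

section Tracing

variable {X : Type*} [MetricSpace X] {f : X → X}

/-- A point can be replaced by a related one which follows the given orbit up to time `m`, and,
after a delay bounded in terms of the precision only, the orbit of `q` for ever. -/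
theorem exists_shadowing_switch [CompactSpace X] (hf : Continuous f) (hct : ChainTransitive f)
    (hdsp : HasDSP f) {ε : ℝ} (hε : 0 < ε) :
    ∃ N : ℕ, ∀ (z : X) (m : ℕ) (q : X), ∃ (z' : X) (T : ℕ), m < T ∧ T ≤ m + N ∧ ChainRel f z z' ∧
      (∀ i ≤ m, dist (f^[i] z) (f^[i] z') ≤ ε) ∧
      ∀ i, dist (f^[T + i] z') (f^[i] q) ≤ ε := by
  obtain ⟨δ, hδ, hsh⟩ := hct.exists_shadowing hf hdsp hε
  obtain ⟨N, hN⟩ := hct.exists_reach_le hδ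
  refine ⟨N, fun z m q => ?_⟩
  obtain ⟨l, hlN, hl, hr⟩ := hN (f^[m] z) q
  obtain ⟨c, hc0, hcl, hc⟩ := hr.exists_seq
  let w : ℕ → X := fun i =>
    if i ≤ m then f^[i] z else if i ≤ m + l then c (i - m) else f^[i - (m + l)] q
  have h1 : ∀ i ≤ m, w i = f^[i] z := fun i hi => if_pos hi
  have h2 : ∀ i ≤ l, w (m + i) = c i := by
    intro i hi
    rcases Nat.eq_zero_or_pos i with rfl | hi0
    · rw [add_zero, h1 m le_rfl, hc0]
    · simp only [w]
      rw [if_neg (by omega), if_pos (by omega), Nat.add_sub_cancel_left]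
  have h3 : ∀ i, w (m + l + i) = f^[i] q := by
    intro i
    rcases Nat.eq_zero_or_pos i with rfl | hi0
    · rw [add_zero, h2 l le_rfl, hcl, Function.iterate_zero, id]
    · simp only [w]
      rw [if_neg (by omega), if_neg (by omega), Nat.add_sub_cancel_left]
  obtain ⟨z', hzz', hz'⟩ := hsh w (fun i => by
    rcases lt_or_ge i m with hi | hi
    · rw [h1 i hi.le, h1 (i + 1) hi, Function.iterate_succ_apply', dist_self]
      exact hδ
    · obtain ⟨i, rfl⟩ := Nat.exists_eq_add_of_le hi
      rcases lt_or_ge i l with hi | hi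
      · rw [h2 i hi.le, add_assoc, h2 (i + 1) hi]
        exact hc i hi
      · obtain ⟨i, rfl⟩ := Nat.exists_eq_add_of_le hi
        rw [← add_assoc, h3, add_assoc _ i 1, h3, Function.iterate_succ_apply', dist_self]
        exact hδ)
  refine ⟨z', m + l, by omega, by omega, by simpa [h1 0 (Nat.zero_le m)] using hzz',
    fun i hi => ?_, fun i => ?_⟩
  · rw [dist_comm, ← h1 i hi]
    exact hz' i
  · rw [← h3 i]
    exact hz' (m + l + i)

/-- The orbit of `z` follows, with errors tending to `0`, the orbits of `p 0`, `p 1`, … one after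
the other: that of `p k` from time `T k` on, during a time `L k` that exceeds, by a factor
tending to infinity, both all that went before and the following delay. -/
structure IsTracing {X : Type*} [MetricSpace X] (f : X → X) (p : ℕ → X) (z : X) (T L : ℕ → ℕ)
    (η : ℕ → ℝ) : Prop where
  tendsto : Tendsto η atTop (𝓝 0)
  dist_le : ∀ k, ∀ i < L k, dist (f^[T k + i] z) (f^[i] (p k)) ≤ η k
  lt : ∀ k, T k + L k < T (k + 1)
  mul_le : ∀ k, k * (T k + (T (k + 1) - (T k + L k))) ≤ L k

/-- The point `z` is the limit of points `z k`, where `z (k + 1)` comes from `z k` by a switch from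
the orbit of `p k` to that of `p (k + 1)`, with geometrically decreasing errors. The bound for the
delay of a switch is known before its time has to be fixed. -/
theorem exists_isTracing [CompactSpace X] (hf : Continuous f) (hct : ChainTransitive f)
    (hdsp : HasDSP f) (x : X) {ε : ℝ} (hε : 0 < ε) (p : ℕ → X) :
    ∃ z, ChainRel f x z ∧ dist x z ≤ ε ∧ ∃ T L η, IsTracing f p z T L η := by
  choose N hN using fun k : ℕ =>
    exists_shadowing_switch hf hct hdsp (ε := ε / 2 / 2 ^ k) (by positivity)
  choose ζ τ hτ hτN hrel hold hnew using hN
  let len : ℕ → ℕ → ℕ := fun k t => k * (t + N k)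
  let st : ℕ → X × ℕ := fun k => Nat.rec (x, 0) (fun k s =>
    (ζ k s.1 (s.2 + len k s.2) (p (k + 1)), τ k s.1 (s.2 + len k s.2) (p (k + 1)))) k
  let zs : ℕ → X := fun k => (st k).1
  let T : ℕ → ℕ := fun k => (st k).2
  let L : ℕ → ℕ := fun k => len k (T k)
  have hzs : ∀ k, zs (k + 1) = ζ k (zs k) (T k + L k) (p (k + 1)) := fun k => rfl
  have hT : ∀ k, T (k + 1) = τ k (zs k) (T k + L k) (p (k + 1)) := fun k => rfl
  have hlt : ∀ k, T k + L k < T (k + 1) := fun k => hτ k _ _ _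
  have hmono : Monotone fun k => T k + L k := monotone_nat_of_le_succ fun k =>
    (hlt k).le.trans (Nat.le_add_right _ _)
  have hstep : ∀ k, ∀ i ≤ T k + L k, dist (f^[i] (zs k)) (f^[i] (zs (k + 1))) ≤ ε / 2 / 2 ^ k :=
    fun k => hold k _ _ _
  have hx : ∀ k, ChainRel f x (zs k) := by
    intro k
    induction k with
    | zero => exact hct.chainRel_refl x
    | succ k ih => exact hct.chainRel_trans ih (hrel k _ _ _)
  obtain ⟨z, hz⟩ := cauchySeq_tendsto_of_complete (cauchySeq_of_le_geometric_two (C := ε)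
    (f := zs) fun k => hstep k 0 (Nat.zero_le _))
  have hlim : ∀ k, ∀ i ≤ T k + L k, dist (f^[i] (zs k)) (f^[i] z) ≤ ε / 2 ^ k := by
    intro k i hi
    have h1 : Tendsto (fun j => f^[i] (zs (k + j))) atTop (𝓝 (f^[i] z)) :=
      ((hf.iterate i).tendsto z).comp (hz.comp (tendsto_add_atTop_nat k |>.congr fun j =>
        add_comm j k))
    refine dist_le_of_le_geometric_two_of_tendsto₀ (C := ε / 2 ^ k) (fun j => ?_) h1
    have h2 := hstep (k + j) i (hi.trans (hmono (Nat.le_add_right k j)))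
    rw [← add_assoc]
    refine h2.trans (le_of_eq ?_)
    rw [pow_add]
    field_simp
  refine ⟨z, hct.chainRel_of_approx fun δ hδ => ?_,
    by simpa [zs, st] using hlim 0 0 (Nat.zero_le _), T, L, fun k => 2 * ε / 2 ^ k, ?_, ?_, hlt, ?_⟩
  · obtain ⟨k, hk⟩ := ((Metric.tendsto_nhds.1 hz) δ hδ).exists
    exact ⟨zs k, hk, hct.chainRel_iff.1 (hx k) δ hδ⟩
  · have := tendsto_pow_atTop_nhds_zero_of_lt_one (r := (1 / 2 : ℝ)) (by norm_num) (by norm_num)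
    have h2 := this.const_mul (2 * ε)
    rw [mul_zero] at h2
    refine h2.congr fun k => ?_
    rw [one_div, inv_pow]
    rfl
  · intro k i hi
    rcases k with _ | k
    · simp [L, len] at hi
    · have h1 : dist (f^[T (k + 1) + i] (zs (k + 1))) (f^[i] (p (k + 1))) ≤ ε / 2 / 2 ^ k :=
        hnew k _ _ _ i
      have h2 := hlim (k + 1) (T (k + 1) + i) (by omega)
      have h3 : ε / 2 / 2 ^ k = ε / 2 ^ (k + 1) := by
        rw [pow_succ]
        field_simp
      have h4 : 2 * ε / 2 ^ (k + 1) = ε / 2 ^ (k + 1) + ε / 2 ^ (k + 1) := by ring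
      rw [h4]
      rw [h3] at h1
      refine (dist_triangle_left _ _ (f^[T (k + 1) + i] (zs (k + 1)))).trans (add_le_add h2 h1)
  · intro k
    refine Nat.mul_le_mul_left k (Nat.add_le_add_left ?_ _)
    have : T (k + 1) ≤ T k + L k + N k := hτN k _ _ _
    omega

variable {p : ℕ → X} {z : X} {T L : ℕ → ℕ} {η : ℕ → ℝ}

theorem IsTracing.strictMono (h : IsTracing f p z T L η) : StrictMono T :=
  strictMono_nat_of_lt_succ fun k => (Nat.le_add_right _ _).trans_lt (h.lt k)

/-- At a time `n` between `T (k + 1)` and `T (k + 2)`, the visits to a small ball around a point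
outside `K` are confined to the times before `T k` and to the delays ending at `T (k + 1)` and
`T (k + 2)`; each of the two summands so obtained is at most `n / k`. -/
theorem IsTracing.omegaBar_subset (h : IsTracing f p z T L η) {K : Set X}
    (hK : IsClosed K) (hinv : MapsTo f K K) (hp : ∀ k, p k ∈ K) : omegaBar f z ⊆ K := by
  intro y hy
  by_contra hyK
  obtain ⟨ε, hε, hball⟩ := Metric.isOpen_iff.1 hK.isOpen_compl y hyK
  refine absurd (hy (ε / 2) (half_pos hε)) (not_lt.2 (upperDensity_nonpos fun j => ?_))
  obtain ⟨k₀, hk₀⟩ := eventually_atTop.1 (h.tendsto.eventually (gt_mem_nhds (half_pos hε)))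
  set A : Set ℕ := {i | f^[i] z ∈ Metric.ball y (ε / 2)} with hA
  have hout : ∀ k ≥ k₀, ∀ i, T k ≤ i → i < T k + L k → i ∉ A := by
    intro k hk i hi hi' hiA
    obtain ⟨i, rfl⟩ := Nat.exists_eq_add_of_le hi
    have h1 := h.dist_le k i (by omega)
    have h2 := hk₀ k hk
    have h3 : dist (f^[T k + i] z) y < ε / 2 := hiA
    refine hball (?_ : f^[i] (p k) ∈ _) (hinv.iterate i (hp k))
    rw [Metric.mem_ball]
    linarith [dist_triangle_left (f^[i] (p k)) y (f^[T k + i] z)]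
  filter_upwards [eventually_ge_atTop (T (max k₀ j + 1))] with n hn
  have hex : ∃ m, n < T m := ⟨n + 1, (Nat.lt_succ_self n).trans_le (h.strictMono.le_apply)⟩
  obtain ⟨k, hk, hkn, hnk⟩ : ∃ k ≥ max k₀ j, T (k + 1) ≤ n ∧ n < T (k + 1 + 1) := by
    have h1 : max k₀ j + 1 < Nat.find hex := by
      by_contra! hle
      exact absurd (Nat.find_spec hex) (not_lt.2 ((h.strictMono.monotone hle).trans hn))
    refine ⟨Nat.find hex - 2, by omega, ?_, ?_⟩
    · exact not_lt.1 (Nat.find_min hex (m := Nat.find hex - 2 + 1) (by omega))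
    · rw [show Nat.find hex - 2 + 1 + 1 = Nat.find hex by omega]
      exact Nat.find_spec hex
  have hkk₀ : k₀ ≤ k := (le_max_left _ _).trans hk
  have hkj : j ≤ k := (le_max_right _ _).trans hk
  have hsub : A ∩ Iio n ⊆ ((Finset.range (T k) ∪ Finset.Ico (T k + L k) (T (k + 1)) ∪
      Finset.Ico (T (k + 1) + L (k + 1)) n : Finset ℕ) : Set ℕ) := by
    rintro i ⟨hiA, hin⟩
    rw [mem_Iio] at hin
    simp only [Finset.coe_union, Finset.coe_range, Finset.coe_Ico, mem_union, mem_Iio, mem_Ico]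
    by_contra! hcon
    by_cases hi1 : i < T k
    · omega
    · by_cases hi2 : i < T k + L k
      · exact hout k hkk₀ i (by omega) hi2 hiA
      · exact hout (k + 1) (by omega) i (by omega) (by omega) hiA
  have hcard : (A ∩ Iio n).ncard ≤
      T k + (T (k + 1) - (T k + L k)) + (n - (T (k + 1) + L (k + 1))) := by
    refine (ncard_le_ncard hsub (Finset.finite_toSet _)).trans ?_
    rw [ncard_coe_finset]
    refine (Finset.card_union_le _ _).trans (add_le_add ((Finset.card_union_le _ _).trans ?_) ?_)
    · simp
    · simp
  have hm1 := h.mul_le k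
  have hm2 := h.mul_le (k + 1)
  have hl1 := h.lt k
  have hl2 := h.lt (k + 1)
  have hd : j * (n - (T (k + 1) + L (k + 1))) ≤ n := by
    rcases Nat.le_total n (T (k + 1) + L (k + 1)) with hle | hle
    · simp [Nat.sub_eq_zero_of_le hle]
    · calc j * (n - (T (k + 1) + L (k + 1)))
          ≤ (k + 1) * (T (k + 1) + (T (k + 1 + 1) - (T (k + 1) + L (k + 1)))) :=
            Nat.mul_le_mul (by omega) (by omega)
        _ ≤ n := by omega
  calc j * (A ∩ Iio n).ncard
      ≤ j * (T k + (T (k + 1) - (T k + L k))) + j * (n - (T (k + 1) + L (k + 1))) := by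
        rw [← mul_add]
        exact Nat.mul_le_mul_left j hcard
    _ ≤ n + n := by
        refine add_le_add ?_ hd
        calc j * (T k + (T (k + 1) - (T k + L k))) ≤ k * (T k + (T (k + 1) - (T k + L k))) :=
              Nat.mul_le_mul_right _ hkj
          _ ≤ n := by omega
    _ = 2 * n := by ring

/-- While an orbit in a minimal set is followed, the visits to a ball around a point of that set
have bounded gaps. -/
theorem IsTracing.subset_omegaBar [CompactSpace X] (hf : Continuous f)
    (h : IsTracing f p z T L η) {M : Set X} (hM : IsMinimalSet f M)
    (hp : ∃ᶠ k in atTop, p k ∈ M) : M ⊆ omegaBar f z := by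
  intro y hy ε hε
  obtain ⟨r, hr, hret⟩ := hM.exists_iterate_mem_lt hf (U := Metric.ball y (ε / 2))
    Metric.isOpen_ball ⟨y, Metric.mem_ball_self (half_pos hε), hy⟩
  refine upperDensity_pos (C := 4 * r) (frequently_atTop.2 fun n₀ => ?_)
  obtain ⟨k, ⟨hη, hkr, hkn⟩, hpk⟩ := ((h.tendsto.eventually (gt_mem_nhds (half_pos hε))).and
    ((eventually_ge_atTop r).and (eventually_ge_atTop n₀))).and_frequently hp |>.exists
  have hkT : k ≤ T k := h.strictMono.le_apply
  have hm := h.mul_le k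
  have hlt := h.lt k
  have hL1 : T k ≤ L k := le_trans (by nlinarith [Nat.zero_le (T (k + 1) - (T k + L k))]) hm
  have hL2 : r ≤ L k := le_trans (hkr.trans hkT) hL1
  refine ⟨T k + L k, by omega, by omega, ?_⟩
  set q := L k / r with hq
  have hvisit : ∀ j < q, ∃ i < r, T k + (r * j + i) ∈ {i | f^[i] z ∈ Metric.ball y ε} ∩
      Iio (T k + L k) := by
    intro j hj
    obtain ⟨i, hi, hiU⟩ := hret _ (hM.prop.mapsTo.iterate (r * j) hpk)
    have hlt : r * j + i < L k := by
      have h1 : r * (j + 1) ≤ r * q := Nat.mul_le_mul_left r hj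
      have h2 : r * q ≤ L k := Nat.mul_div_le _ _
      rw [mul_add] at h1
      omega
    refine ⟨i, hi, ?_, by rw [mem_Iio]; omega⟩
    have h1 := h.dist_le k _ hlt
    rw [← Function.iterate_add_apply, add_comm i, Metric.mem_ball] at hiU
    change dist _ _ < ε
    linarith [dist_triangle (f^[T k + (r * j + i)] z) (f^[r * j + i] (p k)) y]
  choose! v hv hvA using hvisit
  have hcard : q ≤ ({i | f^[i] z ∈ Metric.ball y ε} ∩ Iio (T k + L k)).ncard := by
    have hinj : InjOn (fun j => T k + (r * j + v j)) (Finset.range q : Set ℕ) := by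
      intro a ha b hb hab
      simp only [Finset.coe_range, mem_Iio] at ha hb
      have h1 : r * a + v a = r * b + v b := by
        simpa using hab
      have h2 : (r * a + v a) / r = a := by
        rw [Nat.mul_add_div hr, Nat.div_eq_of_lt (hv a ha), add_zero]
      have h3 : (r * b + v b) / r = b := by
        rw [Nat.mul_add_div hr, Nat.div_eq_of_lt (hv b hb), add_zero]
      rw [← h2, h1, h3]
    calc q = ((Finset.range q).image fun j => T k + (r * j + v j)).card := by
          rw [Finset.card_image_of_injOn hinj, Finset.card_range]
      _ ≤ _ := by
          rw [← ncard_coe_finset]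
          refine ncard_le_ncard ?_ ((finite_Iio _).inter_of_right _)
          intro i hi
          simp only [Finset.coe_image, mem_image, Finset.coe_range, mem_Iio] at hi
          obtain ⟨j, hj, rfl⟩ := hi
          exact hvA j hj
  have hq1 : 1 ≤ q := (Nat.one_le_div_iff hr).2 hL2
  have hq2 : L k < r * (q + 1) := by
    rw [mul_comm]
    exact Nat.lt_mul_of_div_lt (Nat.lt_succ_self _) hr
  calc T k + L k ≤ 2 * (r * (q + 1)) := by omega
    _ ≤ 4 * r * q := by nlinarith
    _ ≤ _ := Nat.mul_le_mul_left _ hcard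

/-- Near every point there is a related one whose `ω̄`-limit set is the union of two given minimal
sets: trace, alternately, an orbit in one and an orbit in the other. -/
theorem exists_omegaBar_eq_union [CompactSpace X] (hf : Continuous f) (hct : ChainTransitive f)
    (hdsp : HasDSP f) {M N : Set X} (hM : IsMinimalSet f M) (hN : IsMinimalSet f N) (x : X)
    {ε : ℝ} (hε : 0 < ε) :
    ∃ z, ChainRel f x z ∧ dist x z ≤ ε ∧ omegaBar f z = M ∪ N := by
  obtain ⟨a, ha⟩ := hM.prop.nonempty
  obtain ⟨b, hb⟩ := hN.prop.nonempty
  obtain ⟨z, hxz, hd, T, L, η, h⟩ :=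
    exists_isTracing hf hct hdsp x hε fun k => if Even k then a else b
  refine ⟨z, hxz, hd, Subset.antisymm ?_ (union_subset ?_ ?_)⟩
  · refine h.omegaBar_subset (hM.prop.isClosed.union hN.prop.isClosed)
      (hM.prop.mapsTo.union_union hN.prop.mapsTo) fun k => ?_
    split_ifs
    · exact Or.inl ha
    · exact Or.inr hb
  · refine h.subset_omegaBar hf hM (frequently_atTop.2 fun n => ⟨2 * n, by omega, ?_⟩)
    simpa using ha
  · refine h.subset_omegaBar hf hN (frequently_atTop.2 fun n => ⟨2 * n + 1, by omega, ?_⟩)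
    simpa using hb

end Tracing

/-! ### Construction of the scrambled set -/

section Assembly

open Cardinal

universe v

theorem mk_le_continuum_of_compactSpace (X : Type v) [MetricSpace X] [CompactSpace X] :
    #X ≤ 𝔠 := by
  rcases isEmpty_or_nonempty X with h | h
  · simp
  · have hinj : Function.Injective fun (x : X) (n : ℕ) =>
        dist x (TopologicalSpace.denseSeq X n) := by
      intro x y hxy
      have h1 : (fun u => dist x u) = fun u => dist y u :=
        (TopologicalSpace.denseRange_denseSeq X).equalizer (continuous_const.dist continuous_id)
          (continuous_const.dist continuous_id) hxy
      simpa using congrFun h1 y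
    have h2 := mk_le_of_injective (β := ULift.{v} (ℕ → ℝ))
      (f := fun x => ⟨fun n => dist x (TopologicalSpace.denseSeq X n)⟩)
      fun x y hxy => hinj (ULift.up_injective hxy)
    simpa [mk_real] using h2

theorem continuum_le_mk_of_injective {Y : Type v} {A : Set Y} {g : ℝ → Y}
    (hg : Function.Injective g) (hA : ∀ r, g r ∈ A) : 𝔠 ≤ #A := by
  have h := mk_le_of_injective (α := ULift.{v} ℝ) (β := A) (f := fun r => ⟨g r.down, hA _⟩)
    fun r s hrs => ULift.down_injective (hg (Subtype.mk.inj hrs))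
  simpa [mk_real] using h

/-- Distinct points get distinct aperiodic minimal sets from an injection `τ`, so that their
`ω̄`-limit sets `τ j ∪ Q` meet exactly in `Q`. The index consists of the point and the scale of the
approximation and of a real number, which provides continuum many points near each point. -/
theorem exists_isOmegaBarScrambled {X : Type v} [MetricSpace X] [CompactSpace X] {f : X → X}
    (hf : Continuous f) (hct : ChainTransitive f) (hdsp : HasDSP f)
    (hent : 0 < Dynamics.coverEntropy f (univ : Set X)) :
    ∃ S : Set X, IsOmegaBarScrambled f S ∧ ∀ (x : X) (ε : ℝ), 0 < ε →
      ∃ g : ℝ → X, Function.Injective g ∧ ∀ r, g r ∈ S ∧ ChainRel f x (g r) ∧ dist x (g r) < ε := by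
  have hcard := continuum_le_mk_aperiodicMinimalSets hf hct hdsp hent
  have hne : Nonempty (aperiodicMinimalSets f) := by
    rw [← mk_ne_zero_iff]
    exact (continuum_pos.trans_le hcard).ne'
  obtain ⟨Q, hQ⟩ := hne
  have hcard' : 𝔠 ≤ #(aperiodicMinimalSets f \ {Q} : Set (Set X)) := by
    by_contra! hlt
    have h1 : #(aperiodicMinimalSets f) ≤
        #(aperiodicMinimalSets f \ {Q} : Set (Set X)) + #({Q} : Set (Set X)) := by
      refine (mk_le_mk_of_subset ?_).trans (mk_union_le _ _)
      rw [sdiff_union_self]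
      exact subset_union_left
    refine absurd (hcard.trans h1) (not_le.2 (add_lt_of_lt aleph0_le_continuum hlt ?_))
    rw [mk_singleton]
    exact one_lt_aleph0.trans aleph0_lt_continuum
  have hidx : #(X × ℕ × ℝ) ≤ 𝔠 := by
    rw [mk_prod]
    refine mul_le_of_le aleph0_le_continuum ?_ ?_
    · simpa using mk_le_continuum_of_compactSpace X
    · simp [mk_real]
  obtain ⟨τ⟩ := hidx.trans hcard'
  have hτmin : ∀ j, IsMinimalSet f (τ j : Set X) := fun j => (τ j).2.1.1
  have hτinj : ∀ i j, i ≠ j → Disjoint (τ i : Set X) (τ j) := fun i j hij => by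
    rw [disjoint_iff_inter_eq_empty, ← not_nonempty_iff_eq_empty]
    exact fun h => hij (τ.injective (Subtype.ext ((hτmin i).eq_of_inter_nonempty (hτmin j) h)))
  have hτQ : ∀ j, Disjoint (τ j : Set X) Q := fun j => by
    rw [disjoint_iff_inter_eq_empty, ← not_nonempty_iff_eq_empty]
    exact fun h => (τ j).2.2 ((hτmin j).eq_of_inter_nonempty hQ.1 h)
  choose z hzrel hzdist hzω using fun j : X × ℕ × ℝ =>
    exists_omegaBar_eq_union hf hct hdsp (hτmin j) hQ.1 j.1
      (ε := 1 / ((j.2.1 : ℝ) + 1)) Nat.one_div_pos_of_nat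
  have hdiff : ∀ i j, i ≠ j → (τ i : Set X) ⊆ omegaBar f (z i) \ omegaBar f (z j) := by
    intro i j hij y hy
    rw [hzω i, hzω j]
    refine ⟨Or.inl hy, ?_⟩
    rintro (h | h)
    · exact disjoint_left.1 (hτinj i j hij) hy h
    · exact disjoint_left.1 (hτQ i) hy h
  have hzinj : Function.Injective z := by
    intro i j hij
    by_contra hne
    obtain ⟨y, hy⟩ := (hτmin i).prop.nonempty
    have := hdiff i j hne hy
    rw [hij, sdiff_self] at this
    exact this
  refine ⟨range z, ?_, fun x ε hε => ?_⟩
  · rintro _ ⟨i, rfl⟩ _ ⟨j, rfl⟩ hij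
    have hne : i ≠ j := fun h => hij (congrArg z h)
    refine ⟨fun hc => (hτmin i).not_countable hf (τ i).2.1.2 (hc.mono (hdiff i j hne)), ?_, ?_⟩
    · obtain ⟨q, hq⟩ := hQ.1.prop.nonempty
      exact ⟨q, by rw [hzω i]; exact Or.inr hq, by rw [hzω j]; exact Or.inr hq⟩
    · obtain ⟨y, hy⟩ := (hτmin i).prop.nonempty
      exact ⟨y, (hdiff i j hne hy).1, (τ i).2.1.2 y hy⟩
  · obtain ⟨n, hn⟩ := exists_nat_one_div_lt hε
    refine ⟨fun r => z (x, n, r), fun r s hrs => ?_, fun r =>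
      ⟨⟨_, rfl⟩, hzrel (x, n, r), (hzdist (x, n, r)).trans_lt hn⟩⟩
    simpa using hzinj hrs

end Assembly

end OmegaBarChaos

/-- `D ∩ S` being `𝔠`-dense in `D` refers to the subspace topology of `D`; `h_top(f)` is
Mathlib's (Bowen–Dinaburg) topological entropy of `f` on the whole space. -/
theorem theorem1p6 {X : Type*} [MetricSpace X] [CompactSpace X] (f : X → X) (hf : Continuous f)
    (hct : OmegaBarChaos.ChainTransitive f) (hdsp : OmegaBarChaos.HasDSP f)
    (hent : 0 < Dynamics.coverEntropy f (Set.univ : Set X)) :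
    (∃ S : Set X, OmegaBarChaos.IsOmegaBarScrambled f S ∧
      (∀ D ∈ OmegaBarChaos.chainClasses f,
        OmegaBarChaos.IsContinuumDense ((Subtype.val : D → X) ⁻¹' S)) ∧
      OmegaBarChaos.IsContinuumDense S) ∧
    OmegaBarChaos.OmegaBarChaotic f := by
  obtain ⟨S, hS, happrox⟩ := OmegaBarChaos.exists_isOmegaBarScrambled hf hct hdsp hent
  have hX := OmegaBarChaos.mk_le_continuum_of_compactSpace X
  have hdense : OmegaBarChaos.IsContinuumDense S := by
    rintro U hU ⟨x, hx⟩
    obtain ⟨ε, hε, hball⟩ := Metric.isOpen_iff.1 hU x hx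
    obtain ⟨g, hg, hgS⟩ := happrox x ε hε
    refine le_antisymm ((Cardinal.mk_set_le _).trans hX)
      (OmegaBarChaos.continuum_le_mk_of_injective hg fun r => ⟨hball ?_, (hgS r).1⟩)
    rw [Metric.mem_ball, dist_comm]
    exact (hgS r).2.2
  refine ⟨⟨S, hS, ?_, hdense⟩, S, fun hc => ?_, hS⟩
  · rintro D ⟨a, rfl⟩ U hU ⟨⟨x, hax⟩, hx⟩
    obtain ⟨ε, hε, hball⟩ := Metric.isOpen_iff.1 hU _ hx
    obtain ⟨g, hg, hgS⟩ := happrox x ε hε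
    refine le_antisymm (((Cardinal.mk_set_le _).trans (Cardinal.mk_set_le _)).trans hX)
      (OmegaBarChaos.continuum_le_mk_of_injective
        (g := fun r => ⟨g r, hct.chainRel_trans hax (hgS r).2.1⟩)
        (fun r s h => hg (Subtype.mk.inj h)) fun r => ⟨hball ?_, (hgS r).1⟩)
    rw [Metric.mem_ball, dist_comm]
    exact (hgS r).2.2
  · have hne : Nonempty X := by
      by_contra h
      rw [not_nonempty_iff] at h
      rw [Set.eq_empty_of_isEmpty (Set.univ : Set X), Dynamics.coverEntropy_empty] at hent
      exact not_lt_bot hent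
    have hcard := hdense Set.univ isOpen_univ Set.univ_nonempty
    rw [Set.univ_inter] at hcard
    exact absurd hc.le_aleph0 (not_le.2 (hcard ▸ Cardinal.aleph0_lt_continuum))
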